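/- Let $\mathcal I$ be a non-empty finite set of agents; the modal operators are $\mathrm K_i$ $(i\in\mathcal I)$ and $\mathrm C$. A modal algebra is a Boolean algebra with operators $\Box\in\{\mathrm K_i,\mathrm C\}$ satisfying $\Box 1=1$ and $\Box(x\sqcap y)=\Box x\sqcap\Box y$; put $\mathrm Ex=\bigsqcap_{i\in\mathcal I}\mathrm K_ix$, $\mathrm E^0x=x$, $\mathrm E^{n+1}x=\mathrm E\,\mathrm E^nx$. It is an MH-algebra if for all $x$: $\mathrm Cx\le x$, $\mathrm Cx\le\mathrm E\mathrm Cx$ and $\mathrm C(-x\sqcup\mathrm Ex)\le -x\sqcup\mathrm Cx$. It is a CKL-algebra if for all $x$: $\mathrm Cx\le\mathrm E\mathrm Cx$ and $\mathrm Cx$ is the greatest lower bound of $\{\mathrm E^nx\mid n\in\omega\}$. For a set $X$, let $T(X)$ be the set of terms of modal algebras over the variables $X$; the free MH-algebra $\mathrm F_{\mathrm{MH}}(X)$ is $T(X)/{\sim_{\mathrm{MH}}}$, where $p\sim_{\mathrm{MH}}q$ iff the equation $p=q$ holds in every MH-algebra; $|p|_{\mathrm{MH}}$ is the class of $p$. Formulas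 over a set $P$ of propositional variables are built from $P$, $\top$, $\bot$ with $\land$, $\neg$, $\mathsf K_i$ and $\mathsf C$; $\lor,\supset,\equiv$ are the usual abbreviations and $\mathsf E\phi=\bigwedge_{i\in\mathcal I}\mathsf K_i\phi$. Let $\mathbf{PS}_{\mathrm{MH}}$ be the system with axioms: all tautologies, $\Box(\phi\supset\psi)\supset(\Box\phi\supset\Box\psi)$ for each modal operator $\Box$, $\mathsf C\phi\supset\phi$, $\mathsf C\phi\supset\mathsf E\mathsf C\phi$, $\mathsf C(\phi\supset\mathsf E\phi)\supset(\phi\supset\mathsf C\phi)$; and rules: modus ponens, uniform substitution, necessitation for each $\Box$. Let $\mathbf{PS}_\omega$ be the system obtained by replacing the last axiom by the $\omega$-rule: for all $k\in\omega$, modal operators $\Box_1,\dots,\Box_k$ and formulas $\gamma,\phi_1,\dots,\phi_k,\phi$, from all $\gamma\supset\Box_1(\phi_1\supset\Box_2(\phi_2\supset\cdots\supset\Box_k(\phi_k\supset\mathsf E^n\phi)\cdots))$ $(n\in\omega)$ infer $\gamma\supset\Box_1(\phi_1\supset\Box_2(\phi_2\supset\cdots\supset\Box_k(\phi_k\supset\mathsf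 C\phi)\cdots))$. For either system, the Lindenbaum–Tarski algebra $\mathrm{LT}$ is the modal algebra of formulas modulo $\phi\sim\psi$ iff $\phi\equiv\psi$ is derivable. **Theorem.** Let $X$ be any set. 1. $\mathrm F_{\mathrm{MH}}(X)$ is a CKL-algebra; in particular $\mathrm C|p|_{\mathrm{MH}}=\bigsqcap_{n\in\omega}\mathrm E^n|p|_{\mathrm{MH}}$ for every $p\in T(X)$. 2. If $X$ is countable and $e:P\to X$ is a bijection from the set of propositional variables, then $\mathrm{LT}_{\mathbf{PS}_\omega}=\mathrm{LT}_{\mathbf{PS}_{\mathrm{MH}}}$ (the two equivalence relations on formulas over $P$ coincide), and reading formulas as terms along $e$ induces an isomorphism of modal algebras from each of these Lindenbaum–Tarski algebras onto $\mathrm F_{\mathrm{MH}}(X)$. 3. For all $p,q\in T(X)$ there is a finite $S\subseteq X$ such that for every countable $Z$ with $S\subseteq Z\subseteq X$, $p$ and $q$ are terms over $Z$, and $|p|_{\mathrm{MH}}=|q|_{\mathrm{MH}}$ in $\mathrm F_{\mathrm{MH}}(X)$ if and only if $|p|_{\mathrm{MH}}=|q|_{\mathrm{MH}}$ in $\mathrm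 F_{\mathrm{MH}}(Z)$. -/

import Mathlib

universe v u w t

namespace CKLogic

/-- The modal operators: `K i` for each agent `i`, and `C`. -/
inductive Modality (I : Type w) : Type w
  | K (i : I) : Modality I
  | C : Modality I

/-! ### Modal algebras -/

/-- A Boolean algebra with a normal (meet- and top-preserving) operator for each modality. -/
class ModalAlgebra (I : Type w) (A : Type v) [BooleanAlgebra A] where
  /-- the operators `K i` and `C` of the algebra -/
  box : Modality I → A → A
  box_top : ∀ m, box m ⊤ = ⊤
  box_inf : ∀ m x y, box m (x ⊓ y) = box m x ⊓ box m y

section Algebras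

variable (I : Type w) {A : Type v} [BooleanAlgebra A] [ModalAlgebra I A]

/-- The common knowledge operator `C` of a modal algebra. -/
def opC (x : A) : A := ModalAlgebra.box (Modality.C : Modality I) x

/-- `E x` is the meet of the `K i x` over all agents `i`. -/
def opE [Fintype I] (x : A) : A :=
  Finset.univ.inf fun i : I => ModalAlgebra.box (Modality.K i) x

/-- MH-algebras; here `x ⇨ y` is the Boolean implication `xᶜ ⊔ y`. -/
class IsMHAlgebra (I : Type w) [Fintype I] (A : Type v) [BooleanAlgebra A] [ModalAlgebra I A] :
    Prop where
  opC_le : ∀ x : A, opC I x ≤ x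
  opC_le_opE_opC : ∀ x : A, opC I x ≤ opE I (opC I x)
  opC_ind : ∀ x : A, opC I (xᶜ ⊔ opE I x) ≤ xᶜ ⊔ opC I x

/-- CKL-algebras: `C x` is the greatest lower bound of the set of all `E^n x`. -/
class IsCKLAlgebra (I : Type w) [Fintype I] (A : Type v) [BooleanAlgebra A] [ModalAlgebra I A] :
    Prop where
  opC_le_opE_opC : ∀ x : A, opC I x ≤ opE I (opC I x)
  isGLB_opC : ∀ x : A, IsGLB (Set.range fun n : ℕ => (opE I)^[n] x) (opC I x)

end Algebras

/-- Homomorphisms of modal algebras. -/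
structure IsModalHom (I : Type w) {A B : Type*} [BooleanAlgebra A] [ModalAlgebra I A]
    [BooleanAlgebra B] [ModalAlgebra I B] (f : A → B) : Prop where
  map_bot : f ⊥ = ⊥
  map_top : f ⊤ = ⊤
  map_compl : ∀ x, f xᶜ = (f x)ᶜ
  map_sup : ∀ x y, f (x ⊔ y) = f x ⊔ f y
  map_inf : ∀ x y, f (x ⊓ y) = f x ⊓ f y
  map_box : ∀ (m : Modality I) x, f (ModalAlgebra.box m x) = ModalAlgebra.box m (f x)

/-! ### Terms and free MH-algebras -/

/-- Terms of modal algebras over a set `X` of variables. -/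
inductive MTerm (I : Type w) (X : Type u) : Type (max u w)
  | var (x : X) : MTerm I X
  | zero : MTerm I X
  | one : MTerm I X
  | compl (a : MTerm I X) : MTerm I X
  | sup (a b : MTerm I X) : MTerm I X
  | inf (a b : MTerm I X) : MTerm I X
  | box (m : Modality I) (a : MTerm I X) : MTerm I X

namespace MTerm

variable {I : Type w} {X : Type u}

/-- The value of a term in a modal algebra under an assignment of the variables. -/
def eval {A : Type v} [BooleanAlgebra A] [ModalAlgebra I A] (f : X → A) : MTerm I X → A
  | var x => f x
  | zero => ⊥
  | one => ⊤
  | compl a => (eval f a)ᶜ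
  | sup a b => eval f a ⊔ eval f b
  | inf a b => eval f a ⊓ eval f b
  | box m a => ModalAlgebra.box m (eval f a)

/-- Renaming of variables. -/
def rename {Y : Type*} (f : X → Y) : MTerm I X → MTerm I Y
  | var x => var (f x)
  | zero => zero
  | one => one
  | compl a => compl (rename f a)
  | sup a b => sup (rename f a) (rename f b)
  | inf a b => inf (rename f a) (rename f b)
  | box m a => box m (rename f a)

end MTerm

/-- `a ∼ b` if the equation `a = b` holds in every MH-algebra (in `Type v`). -/
def mhSetoid (I : Type w) [Fintype I] (X : Type u) : Setoid (MTerm I X) where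
  r a b := ∀ (A : Type v) [BooleanAlgebra A] [ModalAlgebra I A] [IsMHAlgebra I A] (f : X → A),
    a.eval f = b.eval f
  iseqv :=
    { refl := fun _ _ _ _ _ _ => rfl
      symm := fun h A _ _ _ f => (h A f).symm
      trans := fun h₁ h₂ A _ _ _ f => (h₁ A f).trans (h₂ A f) }

/-- The free MH-algebra over `X`: terms modulo the equations true in all MH-algebras. -/
def FreeMH (I : Type w) [Fintype I] (X : Type u) : Type (max u w) :=
  Quotient (mhSetoid.{v} I X)

namespace FreeMH

variable {I : Type w} [Fintype I] {X : Type u}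

/-- The class `|a|` of a term. -/
def mk (a : MTerm I X) : FreeMH.{v} I X := Quotient.mk (mhSetoid.{v} I X) a

/-- The operations of the free algebra are induced by the term constructors. -/
instance instBooleanAlgebra : BooleanAlgebra (FreeMH.{v} I X) where
  le p q := Quotient.liftOn₂ p q
    (fun a b => ∀ (A : Type v) [BooleanAlgebra A] [ModalAlgebra I A] [IsMHAlgebra I A]
      (f : X → A), a.eval f ≤ b.eval f)
    (fun a b a' b' ha hb => propext (by
      constructor
      · intro h A _ _ _ f
        rw [← ha A f, ← hb A f]; exact h A f
      · intro h A _ _ _ f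
        rw [ha A f, hb A f]; exact h A f))
  sup := Quotient.map₂ MTerm.sup (fun a a' ha b b' hb A _ _ _ f => by
    simp only [MTerm.eval]; rw [ha A f, hb A f])
  inf := Quotient.map₂ MTerm.inf (fun a a' ha b b' hb A _ _ _ f => by
    simp only [MTerm.eval]; rw [ha A f, hb A f])
  compl := Quotient.map MTerm.compl (fun a a' ha A _ _ _ f => by
    simp only [MTerm.eval]; rw [ha A f])
  top := mk .one
  bot := mk .zero
  le_refl := by rintro ⟨a⟩ A _ _ _ f; exact le_rfl
  le_trans := by rintro ⟨a⟩ ⟨b⟩ ⟨c⟩ h₁ h₂ A _ _ _ f; exact (h₁ A f).trans (h₂ A f)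
  le_antisymm := by
    rintro ⟨a⟩ ⟨b⟩ h₁ h₂
    exact Quotient.sound fun A _ _ _ f => le_antisymm (h₁ A f) (h₂ A f)
  le_sup_left := by rintro ⟨a⟩ ⟨b⟩ A _ _ _ f; exact le_sup_left
  le_sup_right := by rintro ⟨a⟩ ⟨b⟩ A _ _ _ f; exact le_sup_right
  sup_le := by rintro ⟨a⟩ ⟨b⟩ ⟨c⟩ h₁ h₂ A _ _ _ f; exact sup_le (h₁ A f) (h₂ A f)
  inf_le_left := by rintro ⟨a⟩ ⟨b⟩ A _ _ _ f; exact inf_le_left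
  inf_le_right := by rintro ⟨a⟩ ⟨b⟩ A _ _ _ f; exact inf_le_right
  le_inf := by rintro ⟨a⟩ ⟨b⟩ ⟨c⟩ h₁ h₂ A _ _ _ f; exact le_inf (h₁ A f) (h₂ A f)
  le_sup_inf := by rintro ⟨a⟩ ⟨b⟩ ⟨c⟩ A _ _ _ f; exact le_sup_inf
  inf_compl_le_bot := by
    rintro ⟨a⟩ A _ _ _ f; exact (inf_compl_eq_bot (a := a.eval f)).le
  top_le_sup_compl := by
    rintro ⟨a⟩ A _ _ _ f; exact (sup_compl_eq_top (x := a.eval f)).ge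
  le_top := by rintro ⟨a⟩ A _ _ _ f; exact le_top
  bot_le := by rintro ⟨a⟩ A _ _ _ f; exact bot_le

instance instModalAlgebra : ModalAlgebra I (FreeMH.{v} I X) where
  box m := Quotient.map (MTerm.box m) (fun a a' ha A _ _ _ f => by
    simp only [MTerm.eval]; rw [ha A f])
  box_top m := Quotient.sound fun A _ _ _ f => ModalAlgebra.box_top m
  box_inf m := by
    rintro ⟨a⟩ ⟨b⟩
    exact Quotient.sound fun A _ _ _ f => ModalAlgebra.box_inf m _ _

end FreeMH

/-! ### Formulas and proof systems -/

/-- Formulas of common knowledge logic over a set `P` of propositional variables. -/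
inductive Formula (I : Type w) (P : Type u) : Type (max u w)
  | var (x : P) : Formula I P
  | top : Formula I P
  | bot : Formula I P
  | and (φ ψ : Formula I P) : Formula I P
  | neg (φ : Formula I P) : Formula I P
  | box (m : Modality I) (φ : Formula I P) : Formula I P

namespace Formula

variable {I : Type w} {P : Type u}

def or (φ ψ : Formula I P) : Formula I P := neg (and (neg φ) (neg ψ))

def imp (φ ψ : Formula I P) : Formula I P := or (neg φ) ψ

def iff (φ ψ : Formula I P) : Formula I P := and (imp φ ψ) (imp ψ φ)

/-- `C φ` -/
def common (φ : Formula I P) : Formula I P := box Modality.C φ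

/-- `E φ` is the conjunction of the formulas `K i φ` over all agents `i`. -/
noncomputable def everyone [Fintype I] (φ : Formula I P) : Formula I P :=
  (((Finset.univ : Finset I).toList.map fun i => box (Modality.K i) φ)).foldr and top

/-- Uniform substitution. -/
def subst (σ : P → Formula I P) : Formula I P → Formula I P
  | var x => σ x
  | top => top
  | bot => bot
  | and φ ψ => and (subst σ φ) (subst σ ψ)
  | neg φ => neg (subst σ φ)
  | box m φ => box m (subst σ φ)

/-- Truth of a formula under a two-valued assignment `t` to the variables and to the formulas
that begin with a modal operator. -/
def Holds (t : Formula I P → Prop) : Formula I P → Prop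
  | var x => t (var x)
  | top => True
  | bot => False
  | and φ ψ => Holds t φ ∧ Holds t ψ
  | neg φ => ¬ Holds t φ
  | box m φ => t (box m φ)

/-- Tautologies: substitution instances of classical propositional tautologies. -/
def IsTautology (φ : Formula I P) : Prop := ∀ t, Holds t φ

/-- `nest [(□₁, φ₁), …, (□ₖ, φₖ)] χ` is `□₁ (φ₁ ⊃ □₂ (φ₂ ⊃ ⋯ □ₖ (φₖ ⊃ χ) ⋯ ))`. -/
def nest : List (Modality I × Formula I P) → Formula I P → Formula I P
  | [], χ => χ
  | (m, φ) :: l, χ => box m (imp φ (nest l χ))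

/-- A formula read as a term of modal algebras, along a map of the variables. -/
def toTerm {X : Type*} (e : P → X) : Formula I P → MTerm I X
  | var x => .var (e x)
  | top => .one
  | bot => .zero
  | and φ ψ => .inf (toTerm e φ) (toTerm e ψ)
  | neg φ => .compl (toTerm e φ)
  | box m φ => .box m (toTerm e φ)

end Formula

open Formula in
/-- Derivability in the proof system `PS_MH`. -/
inductive ProvMH {I : Type w} [Fintype I] {P : Type u} : Formula I P → Prop
  | taut {φ} : IsTautology φ → ProvMH φ
  | boxK (m φ ψ) : ProvMH (imp (box m (imp φ ψ)) (imp (box m φ) (box m ψ)))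
  | refl (φ) : ProvMH (imp (common φ) φ)
  | step (φ) : ProvMH (imp (common φ) (everyone (common φ)))
  | ind (φ) : ProvMH (imp (common (imp φ (everyone φ))) (imp φ (common φ)))
  | mp {φ ψ} : ProvMH (imp φ ψ) → ProvMH φ → ProvMH ψ
  | subst {φ} (σ : P → Formula I P) : ProvMH φ → ProvMH (φ.subst σ)
  | nec (m) {φ} : ProvMH φ → ProvMH (box m φ)

open Formula in
/-- Derivability in the proof system `PS_ω`, which has an infinitary rule for `C`. -/
inductive ProvOmega {I : Type w} [Fintype I] {P : Type u} : Formula I P → Prop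
  | taut {φ} : IsTautology φ → ProvOmega φ
  | boxK (m φ ψ) : ProvOmega (imp (box m (imp φ ψ)) (imp (box m φ) (box m ψ)))
  | refl (φ) : ProvOmega (imp (common φ) φ)
  | step (φ) : ProvOmega (imp (common φ) (everyone (common φ)))
  | mp {φ ψ} : ProvOmega (imp φ ψ) → ProvOmega φ → ProvOmega ψ
  | subst {φ} (σ : P → Formula I P) : ProvOmega φ → ProvOmega (φ.subst σ)
  | nec (m) {φ} : ProvOmega φ → ProvOmega (box m φ)
  | omega (γ φ) (l : List (Modality I × Formula I P)) :
      (∀ n : ℕ, ProvOmega (imp γ (nest l (everyone^[n] φ)))) →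
      ProvOmega (imp γ (nest l (common φ)))

/-! ### Lindenbaum–Tarski algebras -/

/-- A set of formulas that is closed under the rules of normal modal logic; this is what the
construction of the Lindenbaum–Tarski algebra needs. -/
structure NormalLogic (I : Type w) (P : Type u) where
  Prov : Formula I P → Prop
  taut : ∀ {φ : Formula I P}, φ.IsTautology → Prov φ
  boxK : ∀ (m : Modality I) (φ ψ : Formula I P), Prov (((φ.imp ψ).box m).imp ((φ.box m).imp (ψ.box m)))
  mp : ∀ {φ ψ : Formula I P}, Prov (φ.imp ψ) → Prov φ → Prov ψ
  nec : ∀ (m : Modality I) {φ : Formula I P}, Prov φ → Prov (φ.box m)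

/-- The formulas derivable in `PS_MH`. -/
def psMH (I : Type w) [Fintype I] (P : Type u) : NormalLogic I P where
  Prov := ProvMH
  taut := .taut
  boxK := .boxK
  mp := .mp
  nec := .nec

/-- The formulas derivable in `PS_ω`. -/
def psOmega (I : Type w) [Fintype I] (P : Type u) : NormalLogic I P where
  Prov := ProvOmega
  taut := .taut
  boxK := .boxK
  mp := .mp
  nec := .nec

namespace NormalLogic

variable {I : Type w} {P : Type u} (L : NormalLogic I P)

open Formula

theorem taut1 {φ ψ : Formula I P} (h : ∀ t, Holds t φ → Holds t ψ) (hφ : L.Prov φ) :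
    L.Prov ψ := by
  refine L.mp (L.taut fun t => ?_) hφ
  have := h t
  simp only [imp, Formula.or, Holds]; tauto

theorem taut2 {φ ψ χ : Formula I P} (h : ∀ t, Holds t φ → Holds t ψ → Holds t χ)
    (hφ : L.Prov φ) (hψ : L.Prov ψ) : L.Prov χ := by
  refine L.mp (L.mp (L.taut fun t => ?_) hφ) hψ
  have := h t
  simp only [imp, Formula.or, Holds]; tauto

theorem prov_iff {φ ψ : Formula I P} :
    L.Prov (φ.iff ψ) ↔ L.Prov (φ.imp ψ) ∧ L.Prov (ψ.imp φ) :=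
  ⟨fun h => ⟨L.taut1 (fun t => by simp only [Formula.iff, Holds]; tauto) h,
      L.taut1 (fun t => by simp only [Formula.iff, Holds]; tauto) h⟩,
    fun h => L.taut2 (fun _ h₁ h₂ => ⟨h₁, h₂⟩) h.1 h.2⟩

theorem imp_refl (φ : Formula I P) : L.Prov (φ.imp φ) :=
  L.taut fun t => by simp only [imp, Formula.or, Holds]; tauto

theorem imp_trans {φ ψ χ : Formula I P} (h₁ : L.Prov (φ.imp ψ)) (h₂ : L.Prov (ψ.imp χ)) :
    L.Prov (φ.imp χ) :=
  L.taut2 (fun t => by simp only [imp, Formula.or, Holds]; tauto) h₁ h₂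

theorem box_mono (m : Modality I) {φ ψ : Formula I P} (h : L.Prov (φ.imp ψ)) :
    L.Prov ((φ.box m).imp (ψ.box m)) :=
  L.mp (L.boxK m φ ψ) (L.nec m h)

/-- `φ ∼ ψ` if `φ ≡ ψ` is derivable. -/
def setoid : Setoid (Formula I P) where
  r φ ψ := L.Prov (φ.iff ψ)
  iseqv :=
    { refl := fun φ => L.prov_iff.2 ⟨L.imp_refl φ, L.imp_refl φ⟩
      symm := fun h => L.prov_iff.2 (L.prov_iff.1 h).symm
      trans := fun h₁ h₂ => L.prov_iff.2
        ⟨L.imp_trans (L.prov_iff.1 h₁).1 (L.prov_iff.1 h₂).1,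
          L.imp_trans (L.prov_iff.1 h₂).2 (L.prov_iff.1 h₁).2⟩ }

/-- The Lindenbaum–Tarski algebra. -/
def LT : Type (max u w) := Quotient L.setoid

/-- The class `|φ|` of a formula. -/
def cls (φ : Formula I P) : L.LT := Quotient.mk L.setoid φ

/-- The operations are induced by the connectives, and `|φ| ≤ |ψ|` iff `φ ⊃ ψ` is derivable. -/
instance instBooleanAlgebra : BooleanAlgebra L.LT where
  le p q := Quotient.liftOn₂ p q (fun φ ψ => L.Prov (φ.imp ψ))
    (fun φ ψ φ' ψ' h₁ h₂ => propext
      ⟨fun h => L.imp_trans (L.prov_iff.1 h₁).2 (L.imp_trans h (L.prov_iff.1 h₂).1),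
        fun h => L.imp_trans (L.prov_iff.1 h₁).1 (L.imp_trans h (L.prov_iff.1 h₂).2)⟩)
  sup := Quotient.map₂ Formula.or (fun _ _ ha _ _ hb =>
    L.taut2 (fun t => by simp only [Formula.iff, imp, Formula.or, Holds]; tauto) ha hb)
  inf := Quotient.map₂ Formula.and (fun _ _ ha _ _ hb =>
    L.taut2 (fun t => by simp only [Formula.iff, imp, Formula.or, Holds]; tauto) ha hb)
  compl := Quotient.map Formula.neg (fun _ _ ha =>
    L.taut1 (fun t => by simp only [Formula.iff, imp, Formula.or, Holds]; tauto) ha)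
  top := L.cls .top
  bot := L.cls .bot
  le_refl := by rintro ⟨a⟩; exact L.imp_refl a
  le_trans := by rintro ⟨a⟩ ⟨b⟩ ⟨c⟩ h₁ h₂; exact L.imp_trans h₁ h₂
  le_antisymm := by
    rintro ⟨a⟩ ⟨b⟩ h₁ h₂
    exact Quotient.sound (L.prov_iff.2 ⟨h₁, h₂⟩)
  le_sup_left := by
    rintro ⟨a⟩ ⟨b⟩; exact L.taut fun t => by simp only [imp, Formula.or, Holds]; tauto
  le_sup_right := by
    rintro ⟨a⟩ ⟨b⟩; exact L.taut fun t => by simp only [imp, Formula.or, Holds]; tauto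
  sup_le := by
    rintro ⟨a⟩ ⟨b⟩ ⟨c⟩ h₁ h₂
    exact L.taut2 (fun t => by simp only [imp, Formula.or, Holds]; tauto) h₁ h₂
  inf_le_left := by
    rintro ⟨a⟩ ⟨b⟩; exact L.taut fun t => by simp only [imp, Formula.or, Holds]; tauto
  inf_le_right := by
    rintro ⟨a⟩ ⟨b⟩; exact L.taut fun t => by simp only [imp, Formula.or, Holds]; tauto
  le_inf := by
    rintro ⟨a⟩ ⟨b⟩ ⟨c⟩ h₁ h₂
    exact L.taut2 (fun t => by simp only [imp, Formula.or, Holds]; tauto) h₁ h₂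
  le_sup_inf := by
    rintro ⟨a⟩ ⟨b⟩ ⟨c⟩; exact L.taut fun t => by simp only [imp, Formula.or, Holds]; tauto
  inf_compl_le_bot := by
    rintro ⟨a⟩; exact L.taut fun t => by simp only [imp, Formula.or, Holds]; tauto
  top_le_sup_compl := by
    rintro ⟨a⟩; exact L.taut fun t => by simp only [imp, Formula.or, Holds]; tauto
  le_top := by rintro ⟨a⟩; exact L.taut fun t => by simp only [imp, Formula.or, Holds]; tauto
  bot_le := by rintro ⟨a⟩; exact L.taut fun t => by simp only [imp, Formula.or, Holds]; tauto

instance instModalAlgebra : ModalAlgebra I L.LT where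
  box m := Quotient.map (Formula.box m) (fun _ _ h => L.prov_iff.2
    ⟨L.box_mono m (L.prov_iff.1 h).1, L.box_mono m (L.prov_iff.1 h).2⟩)
  box_top m := Quotient.sound (L.prov_iff.2
    ⟨L.taut fun t => by simp only [imp, Formula.or, Holds]; tauto,
      L.taut1 (fun t => by simp only [imp, Formula.or, Holds]; tauto)
        (L.nec m (L.taut (φ := Formula.top) fun _ => trivial))⟩)
  box_inf m := by
    rintro ⟨a⟩ ⟨b⟩
    refine Quotient.sound (L.prov_iff.2 ⟨?_, ?_⟩)
    · exact L.taut2 (φ := ((a.and b).box m).imp (a.box m)) (ψ := ((a.and b).box m).imp (b.box m))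
        (fun t => by simp only [imp, Formula.or, Holds]; tauto)
        (L.box_mono m (L.taut fun t => by simp only [imp, Formula.or, Holds]; tauto))
        (L.box_mono m (L.taut fun t => by simp only [imp, Formula.or, Holds]; tauto))
    · exact L.taut2 (φ := (a.box m).imp ((b.imp (a.and b)).box m))
        (fun t => by simp only [imp, Formula.or, Holds]; tauto)
        (L.box_mono m (L.taut fun t => by simp only [imp, Formula.or, Holds]; tauto))
        (L.boxK m b (a.and b))

end NormalLogic

end CKLogic

open CKLogic

/-! Everything rests on a finite model property. Call `y` self-evident if `y ≤ E y`. The MH axioms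
say that `C x` is the greatest self-evident element below `x` (`le_opC`). In a finite MH-algebra the
decreasing partial meets of the `E^n x` repeat a value, and that value is self-evident, so `C x` is
above a finite meet of iterates (`exists_inf_iterate_le_opC`).

Given a term and an assignment in an MH-algebra, the finitely many relevant values lie in the image
of a homomorphism `h` from a finite powerset algebra. Pulling back each `K i` as its best lower
approximation, and taking for `C` the greatest self-evident element, turns the powerset into an
MH-algebra in which the term has a value that `h` sends to the original one
(`MTerm.map_eval_filtAlgebra`). So finite powerset MH-algebras decide all equations
(`MTerm.eval_eq_top_of_finite`).

Hence `C x` is the infimum of the `E^n x` in the free algebra: the inequality to prove need only be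
tested where finitely many iterates suffice. For the same reason the ω-rule is sound in finite
algebras, so it proves nothing beyond the finitary system; conversely it derives the induction
axiom. -/

namespace CKLogic

/-! ### Normal operators and `C` as a greatest fixed point -/

section Operators

variable {I : Type w} {A : Type v} [BooleanAlgebra A] [ModalAlgebra I A]

theorem box_mono (m : Modality I) {x y : A} (h : x ≤ y) :
    ModalAlgebra.box m x ≤ ModalAlgebra.box m y := by
  have := ModalAlgebra.box_inf m x y
  rw [inf_eq_left.2 h] at this
  exact inf_eq_left.1 this.symm

variable [Fintype I]

theorem le_opE_iff {b x : A} : b ≤ opE I x ↔ ∀ i : I, b ≤ ModalAlgebra.box (Modality.K i) x := by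
  simp [opE, Finset.le_inf_iff]

theorem opE_mono : Monotone (opE I : A → A) := fun _ _ h =>
  le_opE_iff.2 fun i => (le_opE_iff.1 le_rfl i).trans (box_mono _ h)

theorem opE_top : opE I (⊤ : A) = ⊤ :=
  top_le_iff.1 <| le_opE_iff.2 fun _ => (ModalAlgebra.box_top _).ge

theorem opE_inf (x y : A) : opE I (x ⊓ y) = opE I x ⊓ opE I y :=
  eq_of_forall_le_iff fun b => by
    simp only [le_inf_iff, le_opE_iff, ModalAlgebra.box_inf, forall_and]

theorem le_opE_iterate {b x : A} (hx : b ≤ x) (hb : b ≤ opE I b) (n : ℕ) :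
    b ≤ (opE I)^[n] x := by
  induction n with
  | zero => exact hx
  | succ n ih =>
    rw [Function.iterate_succ_apply']
    exact hb.trans (opE_mono ih)

section MH

variable [IsMHAlgebra I A]

/-- If `b` is self-evident then `bᶜ ⊔ E b = ⊤`, so the induction axiom collapses to `b ≤ C b`, and
`C` is monotone. -/
theorem le_opC {b x : A} (hx : b ≤ x) (hb : b ≤ opE I b) : b ≤ opC I x := by
  have h := IsMHAlgebra.opC_ind (I := I) b
  have h₁ : bᶜ ⊔ opE I b = ⊤ := top_le_iff.1 <| by
    rw [← compl_sup_eq_top (x := b)]; exact sup_le_sup_left hb _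
  rw [h₁, opC, ModalAlgebra.box_top, sup_comm, ← himp_eq, top_le_iff, himp_eq_top_iff] at h
  exact h.trans (box_mono _ hx)

theorem opC_le_iterate (x : A) (n : ℕ) : opC I x ≤ (opE I)^[n] x :=
  le_opE_iterate (IsMHAlgebra.opC_le x) (IsMHAlgebra.opC_le_opE_opC x) n

/-- In a finite MH-algebra `C x` is a finite meet of iterates `E^n x`. -/
theorem exists_inf_iterate_le_opC [Finite A] (x : A) :
    ∃ N : ℕ, (Finset.range N).inf (fun n => (opE I)^[n] x) ≤ opC I x := by
  set m : ℕ → A := fun N => (Finset.range N).inf fun n => (opE I)^[n] x with hm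
  -- This recursion, started at the empty meet `m 0 = ⊤`, turns a stationary value of `m` into a
  -- self-evident element below `x`.
  have hrec : ∀ N, m (N + 1) = x ⊓ opE I (m N) := by
    intro N
    induction N with
    | zero => simp [hm, opE_top]
    | succ N ih =>
      have h : ∀ k, m (k + 1) = (opE I)^[k] x ⊓ m k := fun k => by
        simp only [hm, Finset.range_add_one, Finset.inf_insert]
      rw [h (N + 1), ih]
      nth_rw 2 [← ih]
      rw [h N, opE_inf, Function.iterate_succ_apply']
      exact inf_left_comm _ _ _
  have hanti : Antitone m := antitone_nat_of_succ_le fun N =>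
    Finset.inf_mono (Finset.range_subset_range.2 (Nat.le_succ N))
  -- By pigeonhole some value repeats; since `m` is antitone, it is constant in between, in
  -- particular from `a` to `a + 1`.
  obtain ⟨a, b, hab, hne⟩ : ∃ a b, a < b ∧ m a = m b := by
    obtain ⟨a, b, hne, h⟩ := Finite.exists_ne_map_eq_of_infinite m
    rcases lt_or_gt_of_ne hne with h' | h'
    · exact ⟨a, b, h', h⟩
    · exact ⟨b, a, h', h.symm⟩
  have hstab : m a = x ⊓ opE I (m a) := by
    rw [← hrec]
    exact le_antisymm (hne.le.trans (hanti hab)) (hanti a.le_succ)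
  exact ⟨a, le_opC (hstab.le.trans inf_le_left) (hstab.le.trans inf_le_right)⟩

end MH

end Operators

/-! ### Homomorphisms and the derived operators -/

namespace IsModalHom

variable {I : Type w} {A B : Type*} [BooleanAlgebra A] [ModalAlgebra I A]
  [BooleanAlgebra B] [ModalAlgebra I B] {f : A → B}

theorem map_opE [Fintype I] (hf : IsModalHom I f) (x : A) : f (opE I x) = opE I (f x) := by
  simp only [opE, ← hf.map_box]
  exact Finset.apply_inf_eq_inf_comp f hf.map_inf hf.map_top

theorem map_opE_iterate [Fintype I] (hf : IsModalHom I f) (x : A) (n : ℕ) :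
    f ((opE I)^[n] x) = (opE I)^[n] (f x) :=
  Function.Semiconj.iterate_right (f := f) (fun x => hf.map_opE x) n x

theorem map_opC (hf : IsModalHom I f) (x : A) : f (opC I x) = opC I (f x) := hf.map_box _ x

end IsModalHom

/-! ### Finite models by filtration -/

section Filtration

variable {A : Type v} [BooleanAlgebra A]

/-- Adjoin an element to the range of a homomorphism from a powerset algebra. -/
def adjoinHom {W : Type t} (h : BoundedLatticeHom (Set W) A) (a : A) :
    BoundedLatticeHom (Set (W × Bool)) A where
  -- Each point of `W` is split in two, one half lying inside `a` and the other inside `aᶜ`.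
  toFun S := (h {x | (x, true) ∈ S} ⊓ a) ⊔ (h {x | (x, false) ∈ S} ⊓ aᶜ)
  map_sup' S T := by
    have h₁ : ∀ b, {x | (x, b) ∈ S ⊔ T} = {x | (x, b) ∈ S} ⊔ {x | (x, b) ∈ T} := fun _ => rfl
    simp only [h₁, map_sup, inf_sup_right]
    exact sup_sup_sup_comm _ _ _ _
  map_inf' S T := by
    have h₁ : ∀ b, {x | (x, b) ∈ S ⊓ T} = {x | (x, b) ∈ S} ⊓ {x | (x, b) ∈ T} := fun _ => rfl
    simp only [h₁, map_inf]
    generalize h {x | (x, true) ∈ S} = p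
    generalize h {x | (x, true) ∈ T} = q
    generalize h {x | (x, false) ∈ S} = r
    generalize h {x | (x, false) ∈ T} = s
    have e₁ : (p ⊓ a) ⊓ (s ⊓ aᶜ) = ⊥ := by
      rw [inf_inf_inf_comm, inf_compl_self, inf_bot_eq]
    have e₂ : (r ⊓ aᶜ) ⊓ (q ⊓ a) = ⊥ := by
      rw [inf_inf_inf_comm, compl_inf_self, inf_bot_eq]
    rw [inf_sup_left, inf_sup_right, inf_sup_right, e₁, e₂, sup_bot_eq, bot_sup_eq,
      ← inf_inf_distrib_right, ← inf_inf_distrib_right]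
  map_top' := by
    have h₁ : ∀ b, {x : W | (x, b) ∈ (⊤ : Set (W × Bool))} = ⊤ := fun _ => rfl
    rw [h₁, h₁, map_top, top_inf_eq, top_inf_eq, sup_compl_eq_top]
  map_bot' := by
    have h₁ : ∀ b, {x : W | (x, b) ∈ (⊥ : Set (W × Bool))} = ⊥ := fun _ => rfl
    rw [h₁, h₁, map_bot, bot_inf_eq, bot_inf_eq, sup_bot_eq]

/-- The homomorphism from the two-element powerset algebra. -/
noncomputable def twoHom : BoundedLatticeHom (Set PUnit.{t + 1}) A where
  toFun S := open Classical in if PUnit.unit ∈ S then ⊤ else ⊥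
  map_sup' S T := by
    by_cases h₁ : PUnit.unit ∈ S <;> by_cases h₂ : PUnit.unit ∈ T <;> simp [h₁, h₂]
  map_inf' S T := by
    by_cases h₁ : PUnit.unit ∈ S <;> by_cases h₂ : PUnit.unit ∈ T <;> simp [h₁, h₂]
  map_top' := by simp
  map_bot' := by simp

/-- Finitely many elements of a Boolean algebra lie in the image of a finite powerset algebra. -/
theorem exists_hom_of_list (l : List A) : ∃ (W : Type t) (_ : Finite W)
    (h : BoundedLatticeHom (Set W) A), ∀ a ∈ l, a ∈ Set.range h := by
  induction l with
  | nil => exact ⟨PUnit, inferInstance, twoHom, by simp⟩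
  | cons a l ih =>
    obtain ⟨W, _, h, hl⟩ := ih
    refine ⟨W × Bool, inferInstance, adjoinHom h a, ?_⟩
    intro b hb
    rcases List.mem_cons.1 hb with rfl | hb
    -- The new element is the image of all the `true` halves; an old element `h S` is the image of
    -- both halves of `S`.
    · refine ⟨{x | x.2 = true}, ?_⟩
      have h₁ : h {x : W | True} = ⊤ := map_top h
      have h₂ : h {x : W | False} = ⊥ := map_bot h
      simp only [adjoinHom, BoundedLatticeHom.coe_mk, LatticeHom.coe_mk, SupHom.coe_mk,
        Set.mem_ofPred_eq, Bool.false_eq_true, h₁, h₂]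
      simp
    · obtain ⟨S, rfl⟩ := hl b hb
      refine ⟨{x | x.1 ∈ S}, ?_⟩
      simp only [adjoinHom, BoundedLatticeHom.coe_mk, LatticeHom.coe_mk, SupHom.coe_mk,
        Set.mem_ofPred_eq, Set.ofPred_mem_eq]
      rw [← inf_sup_left, sup_compl_eq_top, inf_top_eq]

variable {I : Type w} [ModalAlgebra I A] {W : Type t} (h : BoundedLatticeHom (Set W) A)

/-- The best approximation of a modal operator along a homomorphism. -/
def filtK (m : Modality I) (x : Set W) : Set W :=
  sSup {b | h b ≤ ModalAlgebra.box m (h x)}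

/-- The greatest self-evident element below `x`. -/
def filtC (I : Type w) [ModalAlgebra I A] (x : Set W) : Set W :=
  sSup {b | b ≤ x ∧ ∀ i : I, h b ≤ ModalAlgebra.box (Modality.K i) (h b)}

variable [Finite W]

/-- The set defining `filtK` contains `⊥` and is closed under binary joins. As `W` is finite, it
contains its supremum, although `h` is only assumed to preserve finite joins. -/
theorem le_filtK_iff {m : Modality I} {b x : Set W} :
    b ≤ filtK h m x ↔ h b ≤ ModalAlgebra.box m (h x) := by
  refine ⟨fun hb => ?_, fun hb => le_sSup hb⟩
  have hmem : filtK h m x ∈ {b | h b ≤ ModalAlgebra.box m (h x)} := by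
    refine SupClosed.sSup_mem_of_nonempty ?_ (Set.toFinite _) ⟨⊥, ?_⟩ subset_rfl
    · intro a ha b hb
      simp only [Set.mem_ofPred_eq, map_sup] at *
      exact sup_le ha hb
    · exact (map_bot h).trans_le bot_le
  exact (OrderHomClass.mono h hb).trans hmem

/-- Joins of self-evident elements are self-evident by monotonicity of the `K i`, so the finite
supremum is attained. -/
theorem filtC_mem (x : Set W) :
    filtC h I x ∈ {b | b ≤ x ∧ ∀ i : I, h b ≤ ModalAlgebra.box (Modality.K i) (h b)} := by
  refine SupClosed.sSup_mem_of_nonempty ?_ (Set.toFinite _) ⟨⊥, bot_le, fun i => ?_⟩ subset_rfl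
  · rintro a ⟨ha, ha'⟩ b ⟨hb, hb'⟩
    refine ⟨sup_le ha hb, fun i => ?_⟩
    rw [map_sup]
    exact sup_le ((ha' i).trans (box_mono _ le_sup_left)) ((hb' i).trans (box_mono _ le_sup_right))
  · exact (map_bot h).trans_le bot_le

/-- The filtration of a modal algebra along a homomorphism from a finite powerset algebra. -/
@[reducible] def filtAlgebra : ModalAlgebra I (Set W) where
  box
    | .K i => filtK h (.K i)
    | .C => filtC h I
  box_top
    | .K i => top_le_iff.1 <| (le_filtK_iff h).2 <| by
        rw [map_top, ModalAlgebra.box_top]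
    | .C => top_le_iff.1 <| le_sSup ⟨le_rfl, fun i => by
        rw [map_top, ModalAlgebra.box_top]⟩
  box_inf
    | .K i, x, y => eq_of_forall_le_iff fun b => by
        simp only [le_inf_iff, le_filtK_iff, map_inf, ModalAlgebra.box_inf]
    | .C, x, y => by
        have hx := filtC_mem (I := I) h x
        have hy := filtC_mem (I := I) h y
        refine le_antisymm (le_inf ?_ ?_) (le_sSup ⟨inf_le_inf hx.1 hy.1, fun i => ?_⟩)
        · exact sSup_le_sSup fun b hb => ⟨hb.1.trans inf_le_left, hb.2⟩
        · exact sSup_le_sSup fun b hb => ⟨hb.1.trans inf_le_right, hb.2⟩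
        · rw [map_inf, ModalAlgebra.box_inf]
          exact inf_le_inf (hx.2 i) (hy.2 i)

/-- The MH axioms are built into the choice of `filtC` as greatest self-evident element; from `A`
only normality of the operators is needed. -/
theorem filtAlgebra_isMHAlgebra [Fintype I] :
    letI : ModalAlgebra I (Set W) := filtAlgebra h
    IsMHAlgebra I (Set W) := by
  let _ : ModalAlgebra I (Set W) := filtAlgebra h
  have hE : ∀ {b x : Set W}, b ≤ opE I x ↔ ∀ i : I, h b ≤ ModalAlgebra.box (.K i) (h x) :=
    le_opE_iff.trans (forall_congr' fun i => le_filtK_iff h)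
  have hC : ∀ x : Set W, opC I x ≤ opE I (opC I x) := fun x => hE.2 (filtC_mem h x).2
  have hle : ∀ x : Set W, opC I x ≤ x := fun x => (filtC_mem (I := I) h x).1
  refine ⟨hle, hC, fun x => ?_⟩
  rw [sup_comm, ← himp_eq, sup_comm, ← himp_eq, le_himp_iff]
  -- It suffices that `C (x ⇨ E x) ⊓ x` is self-evident: its first factor is, and modus ponens puts
  -- the meet below `E x`.
  refine le_sSup ⟨inf_le_right, hE.1 ?_⟩
  rw [opE_inf]
  refine le_inf (inf_le_left.trans (hC _)) ?_
  exact (inf_le_inf_right x (hle _)).trans himp_inf_le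

theorem map_filtK {m : Modality I} {x : Set W}
    (hx : ModalAlgebra.box m (h x) ∈ Set.range h) :
    h (filtK h m x) = ModalAlgebra.box m (h x) := by
  obtain ⟨b, hb⟩ := hx
  refine le_antisymm ((le_filtK_iff h).1 le_rfl) ?_
  rw [← hb]
  exact OrderHomClass.mono h ((le_filtK_iff h).2 hb.le)

/-- The image of `filtC` is self-evident in `A`, so maximality of `C` there bounds it above. A
preimage of `C (h x)` gives the converse by maximality of `filtC`. -/
theorem map_filtC [Fintype I] [IsMHAlgebra I A] {x : Set W}
    (hx : opC I (h x) ∈ Set.range h) :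
    h (filtC h I x) = opC I (h x) := by
  obtain ⟨c, hc⟩ := hx
  have hm := filtC_mem (I := I) h x
  refine le_antisymm (le_opC (OrderHomClass.mono h hm.1) (le_opE_iff.2 hm.2)) ?_
  -- `h` need not be injective, so `c` may fail to lie below `x`; cutting it down to `c ⊓ x` does
  -- not change the image.
  have hcx : h (c ⊓ x) = opC I (h x) := by
    rw [map_inf, hc]
    exact inf_eq_left.2 (IsMHAlgebra.opC_le _)
  rw [← hcx]
  refine OrderHomClass.mono h (le_sSup ⟨inf_le_right, le_opE_iff.1 ?_⟩)
  rw [hcx]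
  exact IsMHAlgebra.opC_le_opE_opC _

end Filtration

/-! ### Finite model property and variables of terms -/

namespace MTerm

variable {I : Type w} {X : Type u}

/-- The values of all subterms of a term. -/
def subvalues {A : Type v} [BooleanAlgebra A] [ModalAlgebra I A] (f : X → A) :
    MTerm I X → List A
  | var x => [f x]
  | zero => []
  | one => []
  | compl a => subvalues f a
  | sup a b => subvalues f a ++ subvalues f b
  | inf a b => subvalues f a ++ subvalues f b
  | box m a => ModalAlgebra.box m (a.eval f) :: subvalues f a

/-- Only values of variables and boxed subterms must lie in the range of `h`: Boolean steps follow
because `h` is a homomorphism, and at a box the filtered operator is exact by `map_filtK` or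
`map_filtC`. -/
theorem map_eval_filtAlgebra [Fintype I] {A : Type v} [BooleanAlgebra A] [ModalAlgebra I A]
    [IsMHAlgebra I A] {W : Type t} [Finite W] (h : BoundedLatticeHom (Set W) A) (f : X → A)
    (g : X → Set W) (hg : ∀ x, f x ∈ Set.range h → h (g x) = f x) (p : MTerm I X)
    (hp : ∀ a ∈ p.subvalues f, a ∈ Set.range h) :
    letI : ModalAlgebra I (Set W) := filtAlgebra h
    h (p.eval g) = p.eval f := by
  let _ : ModalAlgebra I (Set W) := filtAlgebra h
  induction p with
  | var x => exact hg x (hp _ (by simp [subvalues]))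
  | zero => exact map_bot h
  | one => exact map_top h
  | compl a ih =>
    simp only [eval]
    rw [map_compl', ih hp]
  | sup a b iha ihb =>
    simp only [subvalues, List.mem_append] at hp
    simp only [eval]
    rw [map_sup, iha fun a ha => hp a (.inl ha), ihb fun a ha => hp a (.inr ha)]
  | inf a b iha ihb =>
    simp only [subvalues, List.mem_append] at hp
    simp only [eval]
    rw [map_inf, iha fun a ha => hp a (.inl ha), ihb fun a ha => hp a (.inr ha)]
  | box m a ih =>
    simp only [subvalues, List.mem_cons] at hp
    have ha := ih fun a ha => hp a (.inr ha)
    have hr := hp _ (.inl rfl)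
    simp only [eval]
    rw [← ha] at hr ⊢
    cases m with
    | K i => exact map_filtK h hr
    | C => exact map_filtC h hr

/-- Finite model property: a term that is `⊤` in all finite powerset MH-algebras of one universe
is `⊤` in every MH-algebra of any universe. -/
theorem eval_eq_top_of_finite [Fintype I] {p : MTerm I X}
    (hp : ∀ (W : Type t) [Finite W] [ModalAlgebra I (Set W)] [IsMHAlgebra I (Set W)]
      (g : X → Set W), p.eval g = ⊤)
    {A : Type v} [BooleanAlgebra A] [ModalAlgebra I A] [IsMHAlgebra I A] (f : X → A) :
    p.eval f = ⊤ := by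
  obtain ⟨W, _, h, hl⟩ := exists_hom_of_list.{v, t} (p.subvalues f)
  let _ : ModalAlgebra I (Set W) := filtAlgebra h
  have : IsMHAlgebra I (Set W) := filtAlgebra_isMHAlgebra h
  -- Variables with value in the range of `h` get a preimage; the others get a junk value, harmless
  -- since they do not occur in `p`.
  rw [← map_eval_filtAlgebra h f (fun x => Function.invFun h (f x))
    (fun x hx => Function.invFun_eq hx) p hl, hp W, map_top]

theorem eval_rename {Y : Type*} {A : Type v} [BooleanAlgebra A] [ModalAlgebra I A] (r : X → Y)
    (f : Y → A) (p : MTerm I X) : (p.rename r).eval f = p.eval (f ∘ r) := by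
  induction p <;> simp_all [rename, eval]

/-- The variables that occur in a term. -/
def vars : MTerm I X → Set X
  | var x => {x}
  | zero => ∅
  | one => ∅
  | compl a => vars a
  | sup a b => vars a ∪ vars b
  | inf a b => vars a ∪ vars b
  | box _ a => vars a

theorem finite_vars (p : MTerm I X) : p.vars.Finite := by
  induction p <;> simp_all [vars]

theorem exists_rename_eq {Z : Set X} (p : MTerm I X) (hp : p.vars ⊆ Z) :
    ∃ p' : MTerm I Z, p'.rename Subtype.val = p := by
  induction p with
  | var x => exact ⟨var ⟨x, hp rfl⟩, rfl⟩
  | zero => exact ⟨zero, rfl⟩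
  | one => exact ⟨one, rfl⟩
  | compl a ih =>
    obtain ⟨a', rfl⟩ := ih hp
    exact ⟨compl a', rfl⟩
  | sup a b iha ihb =>
    obtain ⟨a', rfl⟩ := iha (Set.subset_union_left.trans hp)
    obtain ⟨b', rfl⟩ := ihb (Set.subset_union_right.trans hp)
    exact ⟨sup a' b', rfl⟩
  | inf a b iha ihb =>
    obtain ⟨a', rfl⟩ := iha (Set.subset_union_left.trans hp)
    obtain ⟨b', rfl⟩ := ihb (Set.subset_union_right.trans hp)
    exact ⟨inf a' b', rfl⟩
  | box m a ih =>
    obtain ⟨a', rfl⟩ := ih hp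
    exact ⟨box m a', rfl⟩

end MTerm

/-! ### The free MH-algebra -/

namespace FreeMH

variable {I : Type w} [Fintype I] {X : Type u}

theorem mk_eq_mk_iff {p q : MTerm I X} : (mk p : FreeMH.{v} I X) = mk q ↔
    ∀ (A : Type v) [BooleanAlgebra A] [ModalAlgebra I A] [IsMHAlgebra I A] (f : X → A),
      p.eval f = q.eval f :=
  ⟨fun h => Quotient.exact h, fun h => Quotient.sound h⟩

theorem mk_rename_eq_iff {Z : Set X} (p q : MTerm I Z) :
    (mk (p.rename Subtype.val) : FreeMH.{v} I X) = mk (q.rename Subtype.val) ↔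
      (mk p : FreeMH.{v} I Z) = mk q := by
  simp only [mk_eq_mk_iff, MTerm.eval_rename]
  refine ⟨fun h A _ _ _ f => ?_, fun h A _ _ _ f => h A _⟩
  -- Variables outside `Z` do not occur in the renamed terms, so the default `⊥` is immaterial.
  have := h A (Function.extend Subtype.val f fun _ => ⊥)
  rwa [Function.extend_comp Subtype.val_injective] at this

/-- The homomorphism from the free algebra determined by an assignment of the variables. -/
def lift {A : Type v} [BooleanAlgebra A] [ModalAlgebra I A] [IsMHAlgebra I A] (f : X → A) :
    FreeMH.{v} I X → A :=
  Quotient.lift (fun p => p.eval f) fun _ _ h => h A f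

theorem isModalHom_lift {A : Type v} [BooleanAlgebra A] [ModalAlgebra I A] [IsMHAlgebra I A]
    (f : X → A) : IsModalHom I (lift f : FreeMH.{v} I X → A) where
  map_bot := rfl
  map_top := rfl
  map_compl := by rintro ⟨a⟩; rfl
  map_sup := by rintro ⟨a⟩ ⟨b⟩; rfl
  map_inf := by rintro ⟨a⟩ ⟨b⟩; rfl
  map_box := by rintro m ⟨a⟩; rfl

theorem le_iff_lift {p q : FreeMH.{v} I X} : p ≤ q ↔
    ∀ (A : Type v) [BooleanAlgebra A] [ModalAlgebra I A] [IsMHAlgebra I A] (f : X → A),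
      lift f p ≤ lift f q := by
  induction p using Quotient.inductionOn
  induction q using Quotient.inductionOn
  exact Iff.rfl

/-- Inequalities in the free algebra only have to be tested in finite powerset algebras. -/
theorem le_of_finite {p q : FreeMH.{v} I X}
    (h : ∀ (W : Type v) [Finite W] [ModalAlgebra I (Set W)] [IsMHAlgebra I (Set W)]
      (g : X → Set W), lift g p ≤ lift g q) : p ≤ q := by
  induction p using Quotient.inductionOn with | _ a
  induction q using Quotient.inductionOn with | _ b
  intro A _ _ _ f
  have : (a.compl.sup b).eval f = ⊤ := MTerm.eval_eq_top_of_finite (fun W _ _ _ g => by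
    have := h W g
    simp only [MTerm.eval]
    rw [sup_comm, ← himp_eq, himp_eq_top_iff]
    exact this) f
  simp only [MTerm.eval] at this
  rwa [sup_comm, ← himp_eq, himp_eq_top_iff] at this

theorem isCKLAlgebra : IsCKLAlgebra I (FreeMH.{v} I X) where
  opC_le_opE_opC x := le_iff_lift.2 fun A _ _ _ f => by
    rw [(isModalHom_lift f).map_opE, (isModalHom_lift f).map_opC]
    exact IsMHAlgebra.opC_le_opE_opC _
  isGLB_opC x := by
    constructor
    · rintro _ ⟨n, rfl⟩
      refine le_iff_lift.2 fun A _ _ _ f => ?_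
      simp only [(isModalHom_lift f).map_opE_iterate, (isModalHom_lift f).map_opC]
      exact opC_le_iterate _ n
    · intro b hb
      refine le_of_finite fun W _ _ _ g => ?_
      rw [(isModalHom_lift g).map_opC]
      -- `lift g` is not known to preserve infinite meets, but in the finite target `N` iterates
      -- already bound `C`.
      obtain ⟨N, hN⟩ := exists_inf_iterate_le_opC (I := I) (lift g x)
      refine le_trans (Finset.le_inf fun n _ => ?_) hN
      rw [← (isModalHom_lift g).map_opE_iterate]
      exact le_iff_lift.1 (hb ⟨n, rfl⟩) _ g

end FreeMH

/-! ### Semantics of formulas -/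

namespace Formula

variable {I : Type w} {P : Type t}

/-- The value of a formula in a modal algebra. -/
def value {A : Type v} [BooleanAlgebra A] [ModalAlgebra I A] (f : P → A) (φ : Formula I P) : A :=
  (φ.toTerm id).eval f

variable {A : Type v} [BooleanAlgebra A] [ModalAlgebra I A] (f : P → A)

theorem eval_toTerm {X : Type u} (e : P → X) (g : X → A) (φ : Formula I P) :
    (φ.toTerm e).eval g = φ.value (g ∘ e) := by
  unfold value
  induction φ <;> simp_all [toTerm, MTerm.eval]

theorem value_and (φ ψ : Formula I P) : (φ.and ψ).value f = φ.value f ⊓ ψ.value f := rfl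

theorem value_box (m : Modality I) (φ : Formula I P) :
    (φ.box m).value f = ModalAlgebra.box m (φ.value f) := rfl

theorem value_common (φ : Formula I P) : φ.common.value f = opC I (φ.value f) := rfl

theorem value_or (φ ψ : Formula I P) : (φ.or ψ).value f = φ.value f ⊔ ψ.value f := by
  change ((φ.value f)ᶜ ⊓ (ψ.value f)ᶜ)ᶜ = _
  rw [compl_inf, compl_compl, compl_compl]

theorem value_imp (φ ψ : Formula I P) : (φ.imp ψ).value f = φ.value f ⇨ ψ.value f := by
  rw [imp, value_or, himp_eq, sup_comm]
  rfl

theorem value_imp_eq_top {φ ψ : Formula I P} :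
    (φ.imp ψ).value f = ⊤ ↔ φ.value f ≤ ψ.value f := by
  rw [value_imp, himp_eq_top_iff]

theorem value_iff_eq_top {φ ψ : Formula I P} :
    (φ.iff ψ).value f = ⊤ ↔ φ.value f = ψ.value f := by
  rw [Formula.iff, value_and, inf_eq_top_iff, value_imp_eq_top, value_imp_eq_top, le_antisymm_iff]

theorem value_everyone [Fintype I] (φ : Formula I P) :
    φ.everyone.value f = opE I (φ.value f) := by
  have h : ∀ (l : List I) (b : A),
      b ≤ value f ((l.map fun i => box (Modality.K i) φ).foldr and top) ↔
        ∀ i ∈ l, b ≤ ModalAlgebra.box (Modality.K i) (φ.value f) := by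
    intro l b
    induction l with
    | nil =>
      simp only [List.map_nil, List.foldr_nil, List.not_mem_nil, false_imp_iff, implies_true,
        iff_true]
      exact le_top
    | cons i l ih =>
      simp only [List.map_cons, List.foldr_cons, value_and, le_inf_iff, ih, List.forall_mem_cons,
        value_box]
  refine eq_of_forall_le_iff fun b => ?_
  rw [everyone, h, le_opE_iff]
  simp

theorem value_everyone_iterate [Fintype I] (φ : Formula I P) (n : ℕ) :
    (everyone^[n] φ).value f = (opE I)^[n] (φ.value f) :=
  Function.Semiconj.iterate_right (f := value f) (fun φ => value_everyone f φ) n φ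

theorem value_subst (σ : P → Formula I P) (φ : Formula I P) :
    (φ.subst σ).value f = φ.value fun x => (σ x).value f := by
  unfold value
  induction φ <;> simp_all [subst, toTerm, MTerm.eval]

/-- The operation on a modal algebra that corresponds to `nest`. -/
def nestOp (l : List (Modality I × Formula I P)) (x : A) : A :=
  l.foldr (fun q y => ModalAlgebra.box q.1 (q.2.value f ⇨ y)) x

theorem value_nest (l : List (Modality I × Formula I P)) (χ : Formula I P) :
    (nest l χ).value f = nestOp f l (χ.value f) := by
  induction l with
  | nil => rfl
  | cons q l ih =>
    obtain ⟨m, φ⟩ := q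
    simp only [nest, value_box, value_imp, ih]
    rfl

theorem nestOp_top (l : List (Modality I × Formula I P)) : nestOp f l (⊤ : A) = ⊤ := by
  induction l with
  | nil => rfl
  | cons q l ih =>
    simp only [nestOp, List.foldr_cons] at ih ⊢
    rw [ih, himp_top, ModalAlgebra.box_top]

theorem nestOp_inf (l : List (Modality I × Formula I P)) (x y : A) :
    nestOp f l (x ⊓ y) = nestOp f l x ⊓ nestOp f l y := by
  induction l with
  | nil => rfl
  | cons q l ih =>
    simp only [nestOp, List.foldr_cons] at ih ⊢
    rw [ih, himp_inf_distrib, ModalAlgebra.box_inf]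

theorem nestOp_mono (l : List (Modality I × Formula I P)) {x y : A} (h : x ≤ y) :
    nestOp f l x ≤ nestOp f l y := by
  have := nestOp_inf f l x y
  rw [inf_eq_left.2 h] at this
  exact inf_eq_left.1 this.symm

/-- Each point `x` of `W` gives the two-valued assignment "`x` belongs to the value", under which a
tautology holds. -/
theorem value_eq_top_of_isTautology {W : Type v} [ModalAlgebra I (Set W)] {φ : Formula I P}
    (hφ : φ.IsTautology) (g : P → Set W) : φ.value g = ⊤ := by
  refine Set.eq_univ_of_forall fun x => ?_
  have h : ∀ ψ : Formula I P, ψ.Holds (fun χ => x ∈ χ.value g) ↔ x ∈ ψ.value g := by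
    intro ψ
    induction ψ with
    | var y => rfl
    | top => exact iff_of_true trivial (Set.mem_univ x)
    | bot => exact iff_of_false id (Set.notMem_empty x)
    | and φ ψ h₁ h₂ => exact and_congr h₁ h₂
    | neg φ h => exact not_congr h
    | box m φ h => rfl
  exact (h φ).1 (hφ _)

end Formula

open Formula

/-- Soundness of the infinitary system for finite MH-algebras. -/
theorem ProvOmega.value_eq_top {I : Type w} [Fintype I] {P : Type t} {φ : Formula I P}
    (h : ProvOmega φ) {W : Type v} [Finite W] [ModalAlgebra I (Set W)] [IsMHAlgebra I (Set W)]
    (f : P → Set W) : φ.value f = ⊤ := by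
  induction h generalizing f with
  | taut h => exact value_eq_top_of_isTautology h f
  | boxK m φ ψ =>
    rw [value_imp_eq_top, value_imp, value_box, value_box, value_box, value_imp, le_himp_iff,
      ← ModalAlgebra.box_inf]
    exact box_mono m himp_inf_le
  | refl φ =>
    rw [value_imp_eq_top]
    exact IsMHAlgebra.opC_le _
  | step φ =>
    rw [value_imp_eq_top, value_everyone]
    exact IsMHAlgebra.opC_le_opE_opC _
  | mp _ _ h₁ h₂ =>
    have := (value_imp_eq_top f).1 (h₁ f)
    rwa [h₂ f, top_le_iff] at this
  | subst σ _ h => rw [value_subst, h]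
  | nec m _ h => rw [value_box, h, ModalAlgebra.box_top]
  | omega γ φ l _ h =>
    rw [value_imp_eq_top, value_nest, value_common]
    -- The first `N` premises suffice, because the nested context `nestOp` is monotone and preserves
    -- finite meets.
    obtain ⟨N, hN⟩ := exists_inf_iterate_le_opC (I := I) (φ.value f)
    refine le_trans ?_ (nestOp_mono f l hN)
    rw [Finset.apply_inf_eq_inf_comp (nestOp f l) (nestOp_inf f l) (nestOp_top f l)]
    refine Finset.le_inf fun n _ => ?_
    have := (value_imp_eq_top f).1 (h n f)
    rwa [value_nest, value_everyone_iterate] at this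

/-! ### Values in Lindenbaum–Tarski algebras -/

namespace NormalLogic

variable {I : Type w} {P : Type t} (L : NormalLogic I P)

theorem cls_le_cls_iff {φ ψ : Formula I P} : L.cls φ ≤ L.cls ψ ↔ L.Prov (φ.imp ψ) := Iff.rfl

theorem cls_eq_top_iff {φ : Formula I P} : L.cls φ = ⊤ ↔ L.Prov φ := by
  rw [← top_le_iff]
  refine L.cls_le_cls_iff.trans ⟨fun h => ?_, fun h => ?_⟩
  · exact L.mp h (L.taut fun _ => trivial)
  · exact L.taut1 (fun t => by simp only [imp, Formula.or, Holds]; tauto) h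

/-- Under the canonical assignment, semantic identities for `value` become identities between
classes, and validity becomes derivability. -/
theorem value_cls (φ : Formula I P) : φ.value (fun x => L.cls (.var x)) = L.cls φ := by
  unfold value
  induction φ with
  | var x => rfl
  | top => rfl
  | bot => rfl
  | and φ ψ h₁ h₂ => simp only [toTerm, MTerm.eval, h₁, h₂]; rfl
  | neg φ h => simp only [toTerm, MTerm.eval, h]; rfl
  | box m φ h => simp only [toTerm, MTerm.eval, h]; rfl

theorem cls_imp (φ ψ : Formula I P) : L.cls (φ.imp ψ) = L.cls φ ⇨ L.cls ψ := by
  rw [← L.value_cls, value_imp, L.value_cls, L.value_cls]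

theorem cls_everyone [Fintype I] (φ : Formula I P) : L.cls φ.everyone = opE I (L.cls φ) := by
  rw [← L.value_cls, value_everyone, L.value_cls]

theorem cls_everyone_iterate [Fintype I] (φ : Formula I P) (n : ℕ) :
    L.cls (everyone^[n] φ) = (opE I)^[n] (L.cls φ) := by
  rw [← L.value_cls, value_everyone_iterate, L.value_cls]

theorem cls_common (φ : Formula I P) : L.cls φ.common = opC I (L.cls φ) := rfl

end NormalLogic

/-! ### Equivalence of the two systems and the isomorphism -/

section Systems

variable {I : Type w} [Fintype I] {P : Type t}

theorem isMHAlgebra_LT_psMH : IsMHAlgebra I (psMH I P).LT where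
  opC_le := by
    rintro ⟨φ⟩
    exact ProvMH.refl φ
  opC_le_opE_opC := by
    rintro ⟨φ⟩
    have h := (psMH I P).cls_le_cls_iff.2 (ProvMH.step φ)
    rwa [NormalLogic.cls_everyone] at h
  opC_ind := by
    rintro ⟨φ⟩
    have h := (psMH I P).cls_le_cls_iff.2 (ProvMH.ind φ)
    rw [NormalLogic.cls_imp, NormalLogic.cls_common, NormalLogic.cls_imp,
      NormalLogic.cls_everyone, himp_eq, himp_eq, sup_comm, sup_comm (NormalLogic.cls _ _)] at h
    exact h

/-- With `c = C (φ ⊃ E φ)`, the class of `c ∧ φ` is self-evident, hence below every `E^n φ`; the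
ω-rule with empty context (`k = 0`) gives `C φ`. -/
theorem ProvOmega.ind (φ : Formula I P) :
    ProvOmega (imp (common (imp φ (everyone φ))) (imp φ (common φ))) := by
  set L := psOmega I P
  set c := common (imp φ (everyone φ))
  have h : L.Prov ((c.and φ).imp φ.common) := by
    refine ProvOmega.omega (c.and φ) φ [] fun n => L.cls_le_cls_iff.1 ?_
    change L.cls (c.and φ) ≤ L.cls (everyone^[n] φ)
    rw [L.cls_everyone_iterate]
    refine le_opE_iterate (inf_le_right : L.cls c ⊓ L.cls φ ≤ _) ?_ n
    rw [opE_inf, ← L.cls_everyone, ← L.cls_everyone]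
    refine le_inf (inf_le_left.trans (L.cls_le_cls_iff.2 (ProvOmega.step _))) ?_
    have h₁ : L.cls c ≤ L.cls (φ.imp φ.everyone) := L.cls_le_cls_iff.2 (ProvOmega.refl _)
    rw [L.cls_imp] at h₁
    exact le_himp_iff.1 h₁
  exact L.taut1 (fun t => by simp only [imp, Formula.or, Holds]; tauto) h

theorem ProvMH.provOmega {φ : Formula I P} (h : ProvMH φ) : ProvOmega φ := by
  induction h with
  | taut h => exact .taut h
  | boxK m φ ψ => exact .boxK m φ ψ
  | refl φ => exact .refl φ
  | step φ => exact .step φ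
  | ind φ => exact .ind φ
  | mp _ _ h₁ h₂ => exact .mp h₁ h₂
  | subst σ _ h => exact .subst σ h
  | nec m _ h => exact .nec m h

/-- Completeness of the finitary system for the finite powerset MH-algebras of one universe. -/
theorem provMH_of_finite {φ : Formula I P}
    (h : ∀ (W : Type v) [Finite W] [ModalAlgebra I (Set W)] [IsMHAlgebra I (Set W)]
      (g : P → Set W), φ.value g = ⊤) : ProvMH φ := by
  have : IsMHAlgebra I (psMH I P).LT := isMHAlgebra_LT_psMH
  refine (psMH I P).cls_eq_top_iff.1 ?_
  rw [← NormalLogic.value_cls]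
  exact MTerm.eval_eq_top_of_finite h _

theorem provOmega_iff_provMH {φ : Formula I P} : ProvOmega φ ↔ ProvMH φ :=
  ⟨fun h => provMH_of_finite.{0} fun _ _ _ _ g => h.value_eq_top g, fun h => h.provOmega⟩

theorem psOmega_eq_psMH : psOmega I P = psMH I P := by
  have h : (ProvOmega : Formula I P → Prop) = ProvMH := by
    ext φ
    exact provOmega_iff_provMH
  simp only [psOmega, psMH, h]

/-- The universe `v` is arbitrary, as finite models exist in every universe; this lets the free
algebra and the formulas live in unrelated universes. -/
theorem provMH_iff {φ : Formula I P} : ProvMH φ ↔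
    ∀ (A : Type v) [BooleanAlgebra A] [ModalAlgebra I A] [IsMHAlgebra I A] (f : P → A),
      φ.value f = ⊤ :=
  ⟨fun h _ _ _ _ f => MTerm.eval_eq_top_of_finite (p := φ.toTerm id)
      (fun (_ : Type) _ _ _ g => h.provOmega.value_eq_top g) f,
    fun h => provMH_of_finite.{v} fun W _ _ _ g => h (Set W) g⟩

theorem mk_toTerm_eq_iff {X : Type u} (e : P ≃ X) {φ ψ : Formula I P} :
    (FreeMH.mk (φ.toTerm e) : FreeMH.{v} I X) = FreeMH.mk (ψ.toTerm e) ↔ ProvMH (φ.iff ψ) := by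
  simp only [FreeMH.mk_eq_mk_iff, provMH_iff.{v}, eval_toTerm, value_iff_eq_top]
  refine ⟨fun h A _ _ _ f => ?_, fun h A _ _ _ f => h A _⟩
  have := h A (f ∘ e.symm)
  rwa [Function.comp_assoc, e.symm_comp_self, Function.comp_id] at this

/-- Formulas have no primitive disjunction, so a term is reached only up to equivalence, by De
Morgan. -/
theorem exists_mk_toTerm_eq {X : Type u} (e : P ≃ X) (p : MTerm I X) :
    ∃ φ : Formula I P, (FreeMH.mk (φ.toTerm e) : FreeMH.{v} I X) = FreeMH.mk p := by
  simp only [FreeMH.mk_eq_mk_iff]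
  induction p with
  | var x => exact ⟨.var (e.symm x), fun A _ _ _ f => by simp [toTerm]⟩
  | zero => exact ⟨.bot, fun A _ _ _ f => rfl⟩
  | one => exact ⟨.top, fun A _ _ _ f => rfl⟩
  | compl a ih =>
    obtain ⟨φ, h⟩ := ih
    exact ⟨φ.neg, fun A _ _ _ f => congrArg compl (h A f)⟩
  | sup a b iha ihb =>
    obtain ⟨φ, h₁⟩ := iha
    obtain ⟨ψ, h₂⟩ := ihb
    refine ⟨φ.or ψ, fun A _ _ _ f => ?_⟩
    rw [eval_toTerm, value_or, ← eval_toTerm, ← eval_toTerm, h₁, h₂]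
    rfl
  | inf a b iha ihb =>
    obtain ⟨φ, h₁⟩ := iha
    obtain ⟨ψ, h₂⟩ := ihb
    exact ⟨φ.and ψ, fun A _ _ _ f => congrArg₂ (· ⊓ ·) (h₁ A f) (h₂ A f)⟩
  | box m a ih =>
    obtain ⟨φ, h⟩ := ih
    exact ⟨φ.box m, fun A _ _ _ f => congrArg (ModalAlgebra.box m) (h A f)⟩

theorem exists_LT_iso {X : Type u} (e : P ≃ X) :
    ∃ f : (psMH I P).LT → FreeMH.{v} I X, Function.Bijective f ∧ IsModalHom I f ∧
      ∀ φ : Formula I P, f ((psMH I P).cls φ) = FreeMH.mk (φ.toTerm e) := by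
  refine ⟨Quotient.lift (fun φ => FreeMH.mk (φ.toTerm e))
    fun _ _ h => (mk_toTerm_eq_iff e).2 h, ⟨?_, ?_⟩, ?_, fun φ => rfl⟩
  · rintro ⟨φ⟩ ⟨ψ⟩ h
    exact Quotient.sound ((mk_toTerm_eq_iff e).1 h)
  · rintro ⟨p⟩
    obtain ⟨φ, h⟩ := exists_mk_toTerm_eq e p
    exact ⟨(psMH I P).cls φ, h⟩
  · refine ⟨rfl, rfl, ?_, ?_, ?_, ?_⟩
    · rintro ⟨φ⟩; rfl
    · rintro ⟨φ⟩ ⟨ψ⟩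
      refine FreeMH.mk_eq_mk_iff.2 fun A _ _ _ f => ?_
      rw [eval_toTerm, value_or, ← eval_toTerm, ← eval_toTerm]
      rfl
    · rintro ⟨φ⟩ ⟨ψ⟩; rfl
    · rintro m ⟨φ⟩; rfl

end Systems

end CKLogic

theorem mainTheorem4 (I : Type w) [Fintype I] [Nonempty I] (X : Type u) :
    -- the free MH-algebra over an arbitrary set is a CKL-algebra
    IsCKLAlgebra I (FreeMH.{v} I X) ∧
    -- for countable `X`, it is the Lindenbaum–Tarski algebra of both proof systems
    (Countable X → ∀ (P : Type t) (e : P ≃ X),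
      (psOmega I P).setoid = (psMH I P).setoid ∧
      (∃ f : (psOmega I P).LT → FreeMH.{v} I X, Function.Bijective f ∧ IsModalHom I f ∧
        ∀ φ : Formula I P, f ((psOmega I P).cls φ) = FreeMH.mk (φ.toTerm e)) ∧
      (∃ f : (psMH I P).LT → FreeMH.{v} I X, Function.Bijective f ∧ IsModalHom I f ∧
        ∀ φ : Formula I P, f ((psMH I P).cls φ) = FreeMH.mk (φ.toTerm e))) ∧
    -- equality of two classes only depends on the finitely many variables that occur
    (∀ p q : MTerm I X, ∃ S : Set X, S.Finite ∧ ∀ Z : Set X, S ⊆ Z → Z.Countable →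
      ∃ p' q' : MTerm I Z, p'.rename Subtype.val = p ∧ q'.rename Subtype.val = q ∧
        ((FreeMH.mk p : FreeMH.{v} I X) = FreeMH.mk q ↔
          (FreeMH.mk p' : FreeMH.{v} I Z) = FreeMH.mk q')) := by
  refine ⟨FreeMH.isCKLAlgebra, fun _ P e => ⟨by rw [psOmega_eq_psMH], ?_, exists_LT_iso e⟩,
    fun p q => ?_⟩
  · rw [psOmega_eq_psMH]
    exact exists_LT_iso e
  · refine ⟨p.vars ∪ q.vars, p.finite_vars.union q.finite_vars, fun Z hZ _ => ?_⟩
    obtain ⟨p', rfl⟩ := p.exists_rename_eq (Set.subset_union_left.trans hZ)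
    obtain ⟨q', rfl⟩ := q.exists_rename_eq (Set.subset_union_right.trans hZ)
    exact ⟨p', q', rfl, rfl, FreeMH.mk_rename_eq_iff p' q'⟩
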